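/- **Lemma (Main lemma).** Let $X$ be a K4.Grz-space and let $\Gamma/\Delta$ be a modal rule, i.e. a pair of finite sets $\Gamma,\Delta$ of classical modal formulae (built from countably many propositional variables with $\bot,\top,\wedge,\neg,\square$). Then $X\not\models\Gamma/\Delta$ if and only if $\sigma\rho X\not\models\Gamma/\Delta$. Here a *modal space* is a Stone space (compact, Hausdorff, with a basis of clopen sets; possibly empty) with a binary relation $R$ such that $R[x]=\{y: xRy\}$ is closed for every point $x$ and $\{x: R[x]\cap U\neq\varnothing\}$ is clopen for every clopen $U$. On its Boolean algebra of clopen sets put $\square U=\{x: R[x]\subseteq U\}$. The space is a *K4-space* if $\square U\subseteq\square\square U$ for all clopen $U$ (then $R$ is transitive), and a *K4.Grz-space* if moreover $\square(\square(U\to\square U)\to U)\subseteq\square U$ for all clopen $U$, where $U\to V=(X\smallsetminus U)\cup V$. An interpretation $V$ maps formulae to clopen sets and commutes with the connectives, $\square$ being interpreted as above. $X\models\Gamma/\Delta$ means that for every interpretation $V$, if $V(\gamma)=X$ for all $\gamma\in\Gamma$, then $V(\delta)=X$ for some $\delta\in\Delta$; $X\not\models\Gamma/\Delta$ is the negation.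 For a K4-space $X$, let $x\sim y$ iff $x=y$ or both $xRy$ and $yRx$, and let $\varrho:X\to X/{\sim}$ be the quotient map. Then $\rho X$ is the space $X/{\sim}$ with the quotient topology and the relations $\varrho(x)\le\varrho(y)$ iff $x=y$ or $xRy$, and $\varrho(x)\sqsubset\varrho(y)$ iff $xRy$ (both are well defined). Finally, $\sigma\rho X$ is the modal space obtained from $\rho X$ by forgetting $\le$, with $\sqsubset$ as its relation. -/

import Mathlib

open TopologicalSpace

universe u

namespace ModalDuality

/-- Classical modal formulae over countably many propositional variables. -/
inductive Formula : Type
  | var : ℕ → Formula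
  | bot : Formula
  | top : Formula
  | and : Formula → Formula → Formula
  | neg : Formula → Formula
  | box : Formula → Formula

/-- A rule `Γ/Δ`: a pair of finite sets of classical modal formulae. -/
structure Rule : Type where
  premises : Finset Formula
  conclusions : Finset Formula

/-- A modal space: a Stone space with a point-closed relation for which the
preimage of every clopen set is clopen. -/
structure ModalSpace : Type (u + 1) where
  carrier : Type u
  [topology : TopologicalSpace carrier]
  [compact : CompactSpace carrier]
  [hausdorff : T2Space carrier]
  [totallyDisconnected : TotallyDisconnectedSpace carrier]
  rel : carrier → carrier → Prop
  isClosed_up : ∀ x, IsClosed {y | rel x y}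
  isClopen_down : ∀ U : Set carrier, IsClopen U → IsClopen {x | ∃ y ∈ U, rel x y}

attribute [instance] ModalSpace.topology ModalSpace.compact ModalSpace.hausdorff
  ModalSpace.totallyDisconnected

/-- A modalized Esakia space `(X, ≤, ⊏)`: a Stone space with a partial order `≤` making it an
Esakia space and a point-closed relation `⊏` whose reflexive closure is `≤` and whose box
operation preserves clopen upsets. -/
structure ModalizedEsakiaSpace : Type (u + 1) where
  carrier : Type u
  [topology : TopologicalSpace carrier]
  [compact : CompactSpace carrier]
  [hausdorff : T2Space carrier]
  [totallyDisconnected : TotallyDisconnectedSpace carrier]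
  le : carrier → carrier → Prop
  sq : carrier → carrier → Prop
  le_refl : ∀ x, le x x
  le_trans : ∀ x y z, le x y → le y z → le x z
  le_antisymm : ∀ x y, le x y → le y x → x = y
  isClosed_up_le : ∀ x, IsClosed {y | le x y}
  isClopen_down_le : ∀ U : Set carrier, IsClopen U → IsClopen {x | ∃ y ∈ U, le x y}
  isClosed_up_sq : ∀ x, IsClosed {y | sq x y}
  box_clopen_upset : ∀ U : Set carrier, IsClopen U → (∀ x y, x ∈ U → le x y → y ∈ U) →
    IsClopen {x | ∀ y, sq x y → y ∈ U} ∧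
      ∀ x x', (∀ y, sq x y → y ∈ U) → le x x' → ∀ y, sq x' y → y ∈ U
  le_iff : ∀ x y, le x y ↔ x = y ∨ sq x y

attribute [instance] ModalizedEsakiaSpace.topology ModalizedEsakiaSpace.compact
  ModalizedEsakiaSpace.hausdorff ModalizedEsakiaSpace.totallyDisconnected

namespace ModalSpace

theorem isClopen_box (X : ModalSpace.{u}) {U : Set X.carrier} (hU : IsClopen U) :
    IsClopen {x | ∀ y, X.rel x y → y ∈ U} := by
  have h := (X.isClopen_down Uᶜ hU.compl).compl
  convert h using 1
  ext x
  simp only [Set.mem_ofPred_eq, Set.mem_compl_iff, not_exists, not_and]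
  exact ⟨fun h y hy hxy => hy (h y hxy), fun h y hxy => by_contra fun hy => h y hy hxy⟩

/-- The operation `□` of the dual modal algebra, the Boolean algebra of clopen sets. -/
def box (X : ModalSpace.{u}) (U : Clopens X.carrier) : Clopens X.carrier :=
  ⟨{x | ∀ y, X.rel x y → y ∈ U}, X.isClopen_box U.isClopen⟩

/-- `X` is a K4-space: its dual algebra satisfies `□a ≤ □□a`. -/
def IsK4 (X : ModalSpace.{u}) : Prop :=
  ∀ U : Clopens X.carrier, X.box U ≤ X.box (X.box U)

/-- `X` is a K4.Grz-space: it is a K4-space whose dual algebra satisfies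
`□(□(a → □a) → a) ≤ □a`. -/
def IsK4Grz (X : ModalSpace.{u}) : Prop :=
  X.IsK4 ∧ ∀ U : Clopens X.carrier,
    X.box (X.box (U ⇨ X.box U) ⇨ U) ≤ X.box U

/-- The interpretation of formulae as clopen sets determined by its values on variables. -/
def interp (X : ModalSpace.{u}) (v : ℕ → Clopens X.carrier) : Formula → Clopens X.carrier
  | .var n => v n
  | .bot => ⊥
  | .top => ⊤
  | .and φ ψ => X.interp v φ ⊓ X.interp v ψ
  | .neg φ => (X.interp v φ)ᶜ
  | .box φ => X.box (X.interp v φ)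

/-- `φ` holds at every point of `X` under the interpretation determined by `v`. -/
def Holds (X : ModalSpace.{u}) (v : ℕ → Clopens X.carrier) (φ : Formula) : Prop :=
  ∀ x : X.carrier, x ∈ X.interp v φ

/-- `X, v ⊨ Γ/Δ`. -/
def Satisfies (X : ModalSpace.{u}) (v : ℕ → Clopens X.carrier) (r : Rule) : Prop :=
  (∀ γ ∈ r.premises, X.Holds v γ) → ∃ δ ∈ r.conclusions, X.Holds v δ

/-- `X ⊨ Γ/Δ`: every interpretation satisfies the rule. -/
def Validates (X : ModalSpace.{u}) (r : Rule) : Prop :=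
  ∀ v : ℕ → Clopens X.carrier, X.Satisfies v r

/-- `X ⊭ Γ/Δ`. -/
def Refutes (X : ModalSpace.{u}) (r : Rule) : Prop :=
  ¬ X.Validates r

theorem IsK4.trans {X : ModalSpace.{u}} (h : X.IsK4) {x y z : X.carrier}
    (hxy : X.rel x y) (hyz : X.rel y z) : X.rel x z := by
  by_contra hxz
  obtain ⟨W, hW, hzW, hWsub⟩ := compact_exists_isClopen_in_isOpen
    (X.isClosed_up x).isOpen_compl (show z ∈ {w | X.rel x w}ᶜ from hxz)
  have hx : x ∈ X.box ⟨Wᶜ, hW.compl⟩ := fun w hw hwW => hWsub hwW hw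
  exact h _ hx y hxy z hyz hzW

/-- The reflexive closure `R⁺` of the relation. -/
def relPlus (X : ModalSpace.{u}) (x y : X.carrier) : Prop :=
  x = y ∨ X.rel x y

theorem IsK4.plus_trans {X : ModalSpace.{u}} (h : X.IsK4) {x y z : X.carrier}
    (hxy : X.relPlus x y) (hyz : X.relPlus y z) : X.relPlus x z := by
  rcases hxy with rfl | hxy
  · exact hyz
  · rcases hyz with rfl | hyz
    · exact Or.inr hxy
    · exact Or.inr (h.trans hxy hyz)

/-- Points are equivalent when they are equal or see each other. -/
def clusterSetoid (X : ModalSpace.{u}) (h : X.IsK4) : Setoid X.carrier where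
  r x y := x = y ∨ (X.rel x y ∧ X.rel y x)
  iseqv :=
    { refl := fun _ => Or.inl rfl
      symm := fun {x y} hxy => hxy.elim (fun e => Or.inl e.symm) fun e => Or.inr e.symm
      trans := fun {x y z} hxy hyz => by
        rcases hxy with rfl | ⟨h1, h2⟩
        · exact hyz
        · rcases hyz with rfl | ⟨h3, h4⟩
          · exact Or.inr ⟨h1, h2⟩
          · exact Or.inr ⟨h.trans h1 h3, h.trans h4 h2⟩ }

theorem rel_congr (X : ModalSpace.{u}) (h : X.IsK4) (a b a' b' : X.carrier)
    (ha : X.clusterSetoid h a a') (hb : X.clusterSetoid h b b') :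
    X.rel a b = X.rel a' b' := by
  have key : ∀ c d c' d' : X.carrier, X.clusterSetoid h c c' → X.clusterSetoid h d d' →
      X.rel c d → X.rel c' d' := by
    intro c d c' d' hc hd hcd
    have h1 : X.rel c' d := by
      rcases hc with rfl | hc
      · exact hcd
      · exact h.trans hc.2 hcd
    rcases hd with rfl | hd
    · exact h1
    · exact h.trans h1 hd.1
  exact propext ⟨key a b a' b' ha hb,
    key a' b' a b ((X.clusterSetoid h).symm ha) ((X.clusterSetoid h).symm hb)⟩

theorem relPlus_congr (X : ModalSpace.{u}) (h : X.IsK4) (a b a' b' : X.carrier)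
    (ha : X.clusterSetoid h a a') (hb : X.clusterSetoid h b b') :
    X.relPlus a b = X.relPlus a' b' := by
  have key : ∀ c d : X.carrier, X.clusterSetoid h c d → X.relPlus c d := by
    intro c d hcd
    exact hcd.imp id And.left
  have ha' := (X.clusterSetoid h).symm ha
  have hb' := (X.clusterSetoid h).symm hb
  exact propext
    ⟨fun e => h.plus_trans (h.plus_trans (key _ _ ha') e) (key _ _ hb),
      fun e => h.plus_trans (h.plus_trans (key _ _ ha) e) (key _ _ hb')⟩

/-- The cluster collapse, with the quotient topology. -/
abbrev ClusterQuotient (X : ModalSpace.{u}) (h : X.IsK4) : Type u :=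
  Quotient (X.clusterSetoid h)

/-- `ϱ(x) ≤ ϱ(y)` iff `R⁺xy`. -/
def quotLe (X : ModalSpace.{u}) (h : X.IsK4) :
    X.ClusterQuotient h → X.ClusterQuotient h → Prop :=
  Quotient.lift₂ X.relPlus (X.relPlus_congr h)

/-- `ϱ(x) ⊏ ϱ(y)` iff `Rxy`. -/
def quotSq (X : ModalSpace.{u}) (h : X.IsK4) :
    X.ClusterQuotient h → X.ClusterQuotient h → Prop :=
  Quotient.lift₂ X.rel (X.rel_congr h)

theorem isClopen_down_relPlus (X : ModalSpace.{u}) {U : Set X.carrier} (hU : IsClopen U) :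
    IsClopen {x | ∃ y ∈ U, X.relPlus x y} := by
  convert hU.union (X.isClopen_down U hU) using 1
  ext x
  constructor
  · rintro ⟨y, hy, rfl | hxy⟩
    · exact Or.inl hy
    · exact Or.inr ⟨y, hy, hxy⟩
  · rintro (hx | ⟨y, hy, hxy⟩)
    · exact ⟨x, hx, Or.inl rfl⟩
    · exact ⟨y, hy, Or.inr hxy⟩

theorem isClosed_up_relPlus (X : ModalSpace.{u}) (x : X.carrier) :
    IsClosed {y | X.relPlus x y} := by
  convert (isClosed_singleton (x := x)).union (X.isClosed_up x) using 1
  ext y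
  simp [relPlus, eq_comm]

theorem isClopen_quot_iff (X : ModalSpace.{u}) (h : X.IsK4) (U : Set (X.ClusterQuotient h)) :
    IsClopen U ↔ IsClopen {x : X.carrier | (Quotient.mk _ x : X.ClusterQuotient h) ∈ U} :=
  (isQuotientMap_quotient_mk' (s := X.clusterSetoid h)).isClopen_preimage.symm

/-- Distinct clusters are separated by a clopen set. -/
theorem quot_totallySeparated (X : ModalSpace.{u}) (h : X.IsK4) :
    TotallySeparatedSpace (X.ClusterQuotient h) := by
  have sep : ∀ x y : X.carrier, ¬ X.relPlus x y → ∃ U : Set (X.ClusterQuotient h),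
      IsClopen U ∧ Quotient.mk _ x ∈ U ∧ Quotient.mk _ y ∈ Uᶜ := by
    intro x y hxy
    obtain ⟨W, hW, hyW, hWsub⟩ := compact_exists_isClopen_in_isOpen
      (X.isClosed_up_relPlus x).isOpen_compl (show y ∈ {w | X.relPlus x w}ᶜ from hxy)
    refine ⟨{q | ¬ ∃ w ∈ W, X.quotLe h q (Quotient.mk _ w)}, ?_, ?_, ?_⟩
    · rw [isClopen_quot_iff]
      exact (X.isClopen_down_relPlus hW).compl
    · rintro ⟨w, hw, hxw⟩
      exact hWsub hw hxw
    · exact fun hn => hn ⟨y, hyW, Or.inl rfl⟩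
  rw [totallySeparatedSpace_iff_exists_isClopen]
  intro a b
  induction a using Quotient.inductionOn with | _ x
  induction b using Quotient.inductionOn with | _ y
  intro hab
  by_cases hxy : X.relPlus x y
  · by_cases hyx : X.relPlus y x
    · exfalso
      apply hab
      apply Quotient.sound
      rcases hxy with e | hxy
      · exact Or.inl e
      · rcases hyx with e | hyx
        · exact Or.inl e.symm
        · exact Or.inr ⟨hxy, hyx⟩
    · obtain ⟨U, hU, hy, hx⟩ := sep y x hyx
      exact ⟨Uᶜ, hU.compl, hx, by simpa using hy⟩
  · exact sep x y hxy

end ModalSpace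

/-- The modalized Esakia space `ρX` of a K4-space `X`. -/
def rho (X : ModalSpace.{u}) (h : X.IsK4) : ModalizedEsakiaSpace.{u} :=
  haveI := X.quot_totallySeparated h
  haveI : T2Space (X.ClusterQuotient h) := inferInstance
  { carrier := X.ClusterQuotient h
    le := X.quotLe h
    sq := X.quotSq h
    le_refl := by
      rintro ⟨x⟩
      exact Or.inl rfl
    le_trans := by
      rintro ⟨x⟩ ⟨y⟩ ⟨z⟩ hxy hyz
      exact h.plus_trans hxy hyz
    le_antisymm := by
      rintro ⟨x⟩ ⟨y⟩ hxy hyx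
      apply Quotient.sound
      rcases hxy with e | hxy
      · exact Or.inl e
      · rcases hyx with e | hyx
        · exact Or.inl e.symm
        · exact Or.inr ⟨hxy, hyx⟩
    isClosed_up_le := by
      rintro ⟨x⟩
      rw [← (isQuotientMap_quotient_mk' (s := X.clusterSetoid h)).isClosed_preimage]
      exact X.isClosed_up_relPlus x
    isClopen_down_le := by
      intro U hU
      rw [X.isClopen_quot_iff h] at hU ⊢
      convert X.isClopen_down_relPlus hU using 1
      ext x
      constructor
      · rintro ⟨⟨y⟩, hy, hxy⟩
        exact ⟨y, hy, hxy⟩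
      · rintro ⟨y, hy, hxy⟩
        exact ⟨Quotient.mk _ y, hy, hxy⟩
    isClosed_up_sq := by
      rintro ⟨x⟩
      rw [← (isQuotientMap_quotient_mk' (s := X.clusterSetoid h)).isClosed_preimage]
      exact X.isClosed_up x
    box_clopen_upset := by
      intro U hU _
      constructor
      · rw [X.isClopen_quot_iff h] at hU ⊢
        convert X.isClopen_box hU using 1
        ext x
        constructor
        · intro hx y hxy
          exact hx (Quotient.mk _ y) hxy
        · rintro hx ⟨y⟩ hxy
          exact hx y hxy
      · rintro ⟨x⟩ ⟨x'⟩ hx hle ⟨y⟩ hy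
        refine hx (Quotient.mk _ y) ?_
        rcases hle with e | hle
        · subst e; exact hy
        · exact h.trans hle hy
    le_iff := by
      rintro ⟨x⟩ ⟨y⟩
      constructor
      · rintro (e | hxy)
        · subst e; exact Or.inl rfl
        · exact Or.inr hxy
      · rintro (e | hxy)
        · rcases Quotient.exact e with e | e
          · exact Or.inl e
          · exact Or.inr e.1
        · exact Or.inr hxy }

/-- The modal space `σY`: the `≤`-free reduct of a modalized Esakia space `Y`. -/
def sigma (Y : ModalizedEsakiaSpace.{u}) : ModalSpace.{u} where
  carrier := Y.carrier
  rel := Y.sq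
  isClosed_up := Y.isClosed_up_sq
  isClopen_down := by
    intro W hW
    have hup : ∀ x y z, Y.sq x y → Y.le y z → Y.sq x z := by
      intro x y z hxy hyz
      have hxz := Y.le_trans x y z ((Y.le_iff x y).2 (Or.inr hxy)) hyz
      rcases (Y.le_iff x z).1 hxz with rfl | h
      · have := Y.le_antisymm x y ((Y.le_iff x y).2 (Or.inr hxy)) hyz
        subst this
        exact hxy
      · exact h
    have hD := Y.isClopen_down_le W hW
    have hB := (Y.box_clopen_upset {x | ∃ y ∈ W, Y.le x y}ᶜ hD.compl (by
      rintro x y hx hxy ⟨w, hw, hyw⟩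
      exact hx ⟨w, hw, Y.le_trans x y w hxy hyw⟩)).1.compl
    convert hB using 1
    ext x
    simp only [Set.mem_ofPred_eq, Set.mem_compl_iff, not_forall, not_not]
    constructor
    · rintro ⟨y, hy, hxy⟩
      exact ⟨y, hxy, y, hy, Y.le_refl y⟩
    · rintro ⟨y, hxy, w, hw, hyw⟩
      exact ⟨w, hw, hup x y w hxy hyw⟩

end ModalDuality

/-! The quotient map from `X` to `σρX` preserves and reflects the relation, so a valuation on `σρX`
pulls back to `X` with the same truth values (`mem_interp_pullback`). This direction does not use
Grz. Conversely, let `v` be a valuation on `X` and `S` a finite subformula-closed set containing the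
rule. A cluster of `X` may contain points of different `S`-types, so `v` need not descend to the
quotient. It is therefore altered: a point passive in its type keeps its type, and any other point
takes the type of a fixed representative of its cluster in the transitive filtration through `S`.
Both recipes are constant on clusters of `X` and locally constant, so a valuation on `σρX` results.
Boxed members of `S` keep their truth values because they are constant on filtration clusters.
Witnesses against a box survive because, by Grz, a point that sees a type sees a passive point of
that type (`IsK4Grz.exists_passive`). Hence the truth lemma `IsK4Grz.mem_interp_quotValuation`, and
`IsK4Grz.holds_quotValuation` for global truth. -/

namespace ModalDuality

/-! ### Finite subformula-closed sets. -/

/-- The set of subformulae of a formula. -/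
def Formula.subformulas : Formula → Set Formula
  | .var n => {.var n}
  | .bot => {.bot}
  | .top => {.top}
  | .and φ ψ => insert (.and φ ψ) (φ.subformulas ∪ ψ.subformulas)
  | .neg φ => insert (.neg φ) φ.subformulas
  | .box φ => insert (.box φ) φ.subformulas

theorem Formula.self_mem_subformulas (φ : Formula) : φ ∈ φ.subformulas := by
  cases φ <;> simp [Formula.subformulas]

theorem Formula.finite_subformulas (φ : Formula) : φ.subformulas.Finite := by
  induction φ with
  | var n => exact Set.finite_singleton _
  | bot => exact Set.finite_singleton _
  | top => exact Set.finite_singleton _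
  | and φ ψ h₁ h₂ => exact (h₁.union h₂).insert _
  | neg φ h => exact h.insert _
  | box φ h => exact h.insert _

/-- A set of formulae containing the immediate subformulae of its members. -/
structure SubformulaClosed (S : Set Formula) : Prop where
  and_left : ∀ {φ ψ}, Formula.and φ ψ ∈ S → φ ∈ S
  and_right : ∀ {φ ψ}, Formula.and φ ψ ∈ S → ψ ∈ S
  neg : ∀ {φ}, Formula.neg φ ∈ S → φ ∈ S
  box : ∀ {φ}, Formula.box φ ∈ S → φ ∈ S

theorem Formula.subformulas_subset {φ ψ : Formula} (h : ψ ∈ φ.subformulas) :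
    ψ.subformulas ⊆ φ.subformulas := by
  induction φ with
  | var n => obtain rfl := h; exact subset_rfl
  | bot => obtain rfl := h; exact subset_rfl
  | top => obtain rfl := h; exact subset_rfl
  | and φ₁ φ₂ h₁ h₂ =>
    rcases h with rfl | h | h
    · exact subset_rfl
    · exact fun χ hχ => Or.inr (Or.inl (h₁ h hχ))
    · exact fun χ hχ => Or.inr (Or.inr (h₂ h hχ))
  | neg φ ih =>
    rcases h with rfl | h
    · exact subset_rfl
    · exact fun χ hχ => Or.inr (ih h hχ)
  | box φ ih =>
    rcases h with rfl | h
    · exact subset_rfl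
    · exact fun χ hχ => Or.inr (ih h hχ)

theorem Formula.subformulaClosed (φ : Formula) : SubformulaClosed φ.subformulas where
  and_left h := subformulas_subset h (Or.inr (Or.inl (self_mem_subformulas _)))
  and_right h := subformulas_subset h (Or.inr (Or.inr (self_mem_subformulas _)))
  neg h := subformulas_subset h (Or.inr (self_mem_subformulas _))
  box h := subformulas_subset h (Or.inr (self_mem_subformulas _))

theorem exists_finite_subformulaClosed (T : Finset Formula) :
    ∃ S : Set Formula, S.Finite ∧ SubformulaClosed S ∧ ∀ φ ∈ T, φ ∈ S := by
  refine ⟨⋃ φ ∈ T, φ.subformulas,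
    T.finite_toSet.biUnion fun φ _ => φ.finite_subformulas, ?_, fun φ hφ =>
      Set.mem_biUnion hφ φ.self_mem_subformulas⟩
  constructor <;> intros <;> simp only [Set.mem_iUnion] at * <;>
    obtain ⟨χ, hχ, h⟩ := ‹∃ _, _› <;> refine ⟨χ, hχ, ?_⟩
  · exact χ.subformulaClosed.and_left h
  · exact χ.subformulaClosed.and_right h
  · exact χ.subformulaClosed.neg h
  · exact χ.subformulaClosed.box h

namespace ModalSpace

variable {X : ModalSpace.{u}}

/-! ### Passive points and the Grz axiom. -/

/-- The passive points of `U`: those from which one cannot leave `U` and come back. -/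
def passive (X : ModalSpace.{u}) (U : Clopens X.carrier) : Clopens X.carrier :=
  U ⊓ X.box (Uᶜ ⇨ X.box Uᶜ)

theorem mem_passive {U : Clopens X.carrier} {x : X.carrier} :
    x ∈ X.passive U ↔
      x ∈ U ∧ ∀ y, X.rel x y → y ∉ U → ∀ z, X.rel y z → z ∉ U := by
  have himp : ∀ (V W : Clopens X.carrier) (y : X.carrier),
      y ∈ V ⇨ W ↔ (y ∈ V → y ∈ W) := by
    intro V W y
    rw [himp_eq]
    change y ∈ W ∨ y ∉ V ↔ _
    tauto
  change x ∈ U ∧ (∀ y, X.rel x y → y ∈ Uᶜ ⇨ X.box Uᶜ) ↔ _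
  simp only [himp]
  rfl

/-- In a K4.Grz-space, a point which sees a clopen set sees one of its passive points. -/
theorem IsK4Grz.exists_passive (hX : X.IsK4Grz) {U : Clopens X.carrier} {x y : X.carrier}
    (hxy : X.rel x y) (hy : y ∈ U) : ∃ z, X.rel x z ∧ z ∈ X.passive U := by
  by_contra! hn
  -- The Grz axiom for the complement of `U`: its antecedent at `x` says exactly that `x` sees no
  -- passive point of `U`.
  refine hX.2 Uᶜ (show x ∈ X.box _ from ?_) y hxy hy
  intro z hz
  rw [himp_eq]
  change z ∉ U ∨ z ∉ X.box (Uᶜ ⇨ X.box Uᶜ)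
  exact not_and_or.1 (hn z hz)

/-- A point of `U` that is not passive can leave `U` and return, so by transitivity it sees a point
of `U`, and `IsK4Grz.exists_passive` applies. -/
theorem IsK4Grz.exists_passive_of_mem (hX : X.IsK4Grz) {U : Clopens X.carrier}
    {x : X.carrier} (hx : x ∈ U) : ∃ z, z ∈ X.passive U := by
  by_cases hp : x ∈ X.passive U
  · exact ⟨x, hp⟩
  · simp only [mem_passive, not_and, not_forall, not_not] at hp
    obtain ⟨y, hxy, _, z, hyz, hz⟩ := hp hx
    obtain ⟨w, _, hw⟩ := hX.exists_passive (hX.1.trans hxy hyz) hz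
    exact ⟨w, hw⟩

/-- The set of passive points of a clopen set does not cut clusters. -/
theorem IsK4.mem_passive_of_rel (h : X.IsK4) {U : Clopens X.carrier} {x y : X.carrier}
    (hxy : X.rel x y) (hyx : X.rel y x) (hx : x ∈ X.passive U) : y ∈ X.passive U := by
  rw [mem_passive] at hx ⊢
  -- If `y` were outside `U`, the path from `x` to `y` and back to `x` would leave `U` and return.
  exact ⟨by_contra fun hy => hx.2 y hxy hy x hyx hx.1, fun z hz => hx.2 z (h.trans hxy hz)⟩

/-! ### Types and the transitive filtration. -/

variable (X) (v : ℕ → Clopens X.carrier) (S : Set Formula)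

/-- The members of `S` true at a point. -/
def truthType (x : X.carrier) : Set Formula :=
  {φ | φ ∈ S ∧ x ∈ X.interp v φ}

/-- The relation of the transitive filtration through `S`, pulled back to the points. -/
def filtrationRel (x y : X.carrier) : Prop :=
  ∀ φ, Formula.box φ ∈ S → x ∈ X.interp v (.box φ) →
    y ∈ X.interp v φ ∧ y ∈ X.interp v (.box φ)

variable {X v S}

theorem mem_interp_of_truthType_eq {x y : X.carrier}
    (h : X.truthType v S x = X.truthType v S y) {φ : Formula} (hφ : φ ∈ S) :
    x ∈ X.interp v φ ↔ y ∈ X.interp v φ :=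
  ⟨fun hx => (h ▸ (⟨hφ, hx⟩ : φ ∈ X.truthType v S x) : φ ∈ X.truthType v S y).2,
    fun hy => (h ▸ (⟨hφ, hy⟩ : φ ∈ X.truthType v S y) : φ ∈ X.truthType v S x).2⟩

theorem isLocallyConstant_truthType (hS : S.Finite) :
    IsLocallyConstant (X.truthType v S) := by
  rw [IsLocallyConstant.iff_exists_open]
  intro x
  refine ⟨⋂ φ ∈ S, {y | y ∈ X.interp v φ ↔ x ∈ X.interp v φ},
    hS.isOpen_biInter fun φ _ => ?_, Set.mem_iInter₂.2 fun φ _ => Iff.rfl, fun y hy => ?_⟩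
  · by_cases hx : x ∈ X.interp v φ
    · simp only [hx, iff_true]
      exact (X.interp v φ).isClopen.isOpen
    · simp only [hx, iff_false]
      exact (X.interp v φ).isClopen.compl.isOpen
  · ext φ
    exact and_congr_right fun hφ => Set.mem_iInter₂.1 hy φ hφ

theorem IsK4.filtrationRel_of_rel (h : X.IsK4) {x y : X.carrier} (hxy : X.rel x y) :
    X.filtrationRel v S x y :=
  fun _ _ hx => ⟨hx y hxy, fun _ hz => hx _ (h.trans hxy hz)⟩

theorem filtrationRel.trans {x y z : X.carrier} (hxy : X.filtrationRel v S x y)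
    (hyz : X.filtrationRel v S y z) : X.filtrationRel v S x z :=
  fun φ hφ hx => hyz φ hφ (hxy φ hφ hx).2

theorem filtrationRel_congr (hS : SubformulaClosed S) {x y x' y' : X.carrier}
    (hx : X.truthType v S x = X.truthType v S x')
    (hy : X.truthType v S y = X.truthType v S y') (hxy : X.filtrationRel v S x y) :
    X.filtrationRel v S x' y' := by
  intro φ hφ hx'
  have := hxy φ hφ ((mem_interp_of_truthType_eq hx hφ).2 hx')
  exact ⟨(mem_interp_of_truthType_eq hy (hS.box hφ)).1 this.1,
    (mem_interp_of_truthType_eq hy hφ).1 this.2⟩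

/-- Points are equivalent when their classes lie in the same cluster of the filtration. -/
def filtrationSetoid (X : ModalSpace.{u}) (v : ℕ → Clopens X.carrier) {S : Set Formula}
    (hS : SubformulaClosed S) : Setoid X.carrier where
  -- Equality of types needs its own clause, as `filtrationRel` need not be reflexive.
  r x y := X.truthType v S x = X.truthType v S y ∨
    (X.filtrationRel v S x y ∧ X.filtrationRel v S y x)
  iseqv :=
    { refl := fun _ => Or.inl rfl
      symm := fun h => h.elim (fun e => Or.inl e.symm) fun e => Or.inr e.symm
      trans := by
        rintro x y z (h | ⟨h₁, h₂⟩) (h' | ⟨h₃, h₄⟩)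
        · exact Or.inl (h.trans h')
        · exact Or.inr ⟨filtrationRel_congr hS h.symm rfl h₃,
            filtrationRel_congr hS rfl h.symm h₄⟩
        · exact Or.inr ⟨filtrationRel_congr hS rfl h' h₁, filtrationRel_congr hS h' rfl h₂⟩
        · exact Or.inr ⟨h₁.trans h₃, h₄.trans h₂⟩ }

theorem mem_interp_box_of_filtrationSetoid {hS : SubformulaClosed S} {x y : X.carrier}
    (h : X.filtrationSetoid v hS x y) {φ : Formula} (hφ : Formula.box φ ∈ S) :
    x ∈ X.interp v (.box φ) ↔ y ∈ X.interp v (.box φ) := by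
  rcases h with h | ⟨h₁, h₂⟩
  · exact mem_interp_of_truthType_eq h hφ
  · exact ⟨fun hx => (h₁ φ hφ hx).2, fun hy => (h₂ φ hφ hy).2⟩

/-! ### Normalization of points. -/

/-- The clopen set of points with the same type as `x`. -/
def typeFiber (X : ModalSpace.{u}) (v : ℕ → Clopens X.carrier) {S : Set Formula}
    (hfin : S.Finite) (x : X.carrier) : Clopens X.carrier :=
  ⟨{y | X.truthType v S y = X.truthType v S x},
    (isLocallyConstant_truthType hfin).isClopen_fiber _⟩

theorem typeFiber_congr {hfin : S.Finite} {x y : X.carrier}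
    (h : X.truthType v S x = X.truthType v S y) :
    X.typeFiber v hfin x = X.typeFiber v hfin y := by
  ext z
  exact ⟨fun hz => Eq.trans hz h, fun hz => Eq.trans hz h.symm⟩

open Classical in
/-- A point is kept if it is passive in the set of points of its type, and is otherwise
replaced by a fixed representative of its filtration cluster. -/
noncomputable def normalize (X : ModalSpace.{u}) (v : ℕ → Clopens X.carrier)
    {S : Set Formula} (hfin : S.Finite) (hS : SubformulaClosed S) (x : X.carrier) :
    X.carrier :=
  if x ∈ X.passive (X.typeFiber v hfin x) then x
  else (Quotient.mk (X.filtrationSetoid v hS) x).out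

section Normalize

variable {hfin : S.Finite} {hS : SubformulaClosed S}

theorem normalize_of_mem {x : X.carrier} (hx : x ∈ X.passive (X.typeFiber v hfin x)) :
    X.normalize v hfin hS x = x := if_pos hx

theorem normalize_of_notMem {x : X.carrier} (hx : x ∉ X.passive (X.typeFiber v hfin x)) :
    X.normalize v hfin hS x = (Quotient.mk (X.filtrationSetoid v hS) x).out := if_neg hx

theorem normalize_equiv (x : X.carrier) :
    X.filtrationSetoid v hS (X.normalize v hfin hS x) x := by
  by_cases hx : x ∈ X.passive (X.typeFiber v hfin x)
  · rw [normalize_of_mem hx]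
  · rw [normalize_of_notMem hx]
    exact Quotient.mk_out (s := X.filtrationSetoid v hS) x

theorem truthType_normalize_of_mem_passive {x y : X.carrier}
    (hy : y ∈ X.passive (X.typeFiber v hfin x)) :
    X.truthType v S (X.normalize v hfin hS y) = X.truthType v S x := by
  have hyx : X.truthType v S y = X.truthType v S x := (mem_passive.1 hy).1
  rw [← typeFiber_congr hyx] at hy
  rw [normalize_of_mem hy, hyx]

/-- Each type fibre splits into two clopen pieces. Passive points keep the common type; the others
share one representative, since points of equal type lie in one filtration cluster. -/
theorem isLocallyConstant_truthType_normalize :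
    IsLocallyConstant fun x => X.truthType v S (X.normalize v hfin hS x) := by
  rw [IsLocallyConstant.iff_exists_open]
  intro x
  by_cases hx : x ∈ X.passive (X.typeFiber v hfin x)
  · refine ⟨X.passive (X.typeFiber v hfin x), Clopens.isOpen _, hx, fun y hy => ?_⟩
    rw [truthType_normalize_of_mem_passive hx, truthType_normalize_of_mem_passive hy]
  · refine ⟨X.typeFiber v hfin x ⊓ (X.passive (X.typeFiber v hfin x))ᶜ,
      (Clopens.isClopen _).isOpen.inter (Clopens.isClopen _).compl.isOpen,
      ⟨rfl, hx⟩, fun y ⟨hy, hy'⟩ => ?_⟩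
    have hyx : X.truthType v S y = X.truthType v S x := hy
    have hyn : y ∉ X.passive (X.typeFiber v hfin y) := by
      rw [typeFiber_congr hyx]
      exact hy'
    simp only [normalize_of_notMem hx, normalize_of_notMem hyn]
    rw [Quotient.sound (s := X.filtrationSetoid v hS) (Or.inl hyx)]

/-- If one point of a cluster is passive in its type, the whole cluster is passive in that type.
Otherwise the points of the cluster may differ in type, but they see each other, so they share a
filtration cluster and its representative. -/
theorem IsK4.truthType_normalize_congr (h : X.IsK4) {x y : X.carrier}
    (hxy : X.clusterSetoid h x y) :
    X.truthType v S (X.normalize v hfin hS x) =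
      X.truthType v S (X.normalize v hfin hS y) := by
  rcases hxy with rfl | ⟨hxy, hyx⟩
  · rfl
  by_cases hx : x ∈ X.passive (X.typeFiber v hfin x)
  · rw [truthType_normalize_of_mem_passive hx,
      truthType_normalize_of_mem_passive (h.mem_passive_of_rel hxy hyx hx)]
  by_cases hy : y ∈ X.passive (X.typeFiber v hfin y)
  · rw [truthType_normalize_of_mem_passive hy,
      truthType_normalize_of_mem_passive (h.mem_passive_of_rel hyx hxy hy)]
  rw [normalize_of_notMem hx, normalize_of_notMem hy,
    Quotient.sound (s := X.filtrationSetoid v hS)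
      (Or.inr ⟨h.filtrationRel_of_rel hxy, h.filtrationRel_of_rel hyx⟩)]

end Normalize

/-! ### The induced valuation on `σρX` and the truth lemma. -/

/-- The valuation on `σρX` given by the types of the normalized points. -/
noncomputable def quotValuation (h : X.IsK4) (v : ℕ → Clopens X.carrier)
    (hfin : S.Finite) (hS : SubformulaClosed S) (n : ℕ) :
    Clopens (sigma (rho X h)).carrier :=
  -- Types are subsets of `S`, so variables outside `S` become false everywhere.
  ⟨{q : X.ClusterQuotient h | Formula.var n ∈ Quotient.lift
      (fun x => X.truthType v S (X.normalize v hfin hS x))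
      (fun _ _ hxy => h.truthType_normalize_congr hxy) q},
    (X.isClopen_quot_iff h _).2 <| by
      constructor
      · rw [← isOpen_compl_iff]
        exact isLocallyConstant_truthType_normalize (hfin := hfin) (hS := hS)
          {t | Formula.var n ∉ t}
      · exact isLocallyConstant_truthType_normalize (hfin := hfin) (hS := hS)
          {t | Formula.var n ∈ t}⟩

/-- The quotient map onto `σρX`. -/
def toQuot (X : ModalSpace.{u}) (h : X.IsK4) (x : X.carrier) : (sigma (rho X h)).carrier :=
  (Quotient.mk _ x : X.ClusterQuotient h)

theorem toQuot_surjective (h : X.IsK4) : Function.Surjective (X.toQuot h) :=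
  Quotient.mk_surjective

theorem IsK4Grz.mem_interp_quotValuation (hX : X.IsK4Grz) (hfin : S.Finite)
    (hS : SubformulaClosed S) {φ : Formula} (hφ : φ ∈ S) (x : X.carrier) :
    X.toQuot hX.1 x ∈
        (sigma (rho X hX.1)).interp (quotValuation hX.1 v hfin hS) φ ↔
      X.normalize v hfin hS x ∈ X.interp v φ := by
  induction φ generalizing x with
  | var n => exact and_iff_right hφ
  | bot => exact Iff.rfl
  | top => exact Iff.rfl
  | and φ ψ ih₁ ih₂ => exact and_congr (ih₁ (hS.and_left hφ) x) (ih₂ (hS.and_right hφ) x)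
  | neg φ ih => exact not_congr (ih (hS.neg hφ) x)
  | box φ ih =>
    have hφ' := hS.box hφ
    rw [mem_interp_box_of_filtrationSetoid (normalize_equiv x) hφ]
    constructor
    · intro hx y hxy
      by_contra hy
      -- Normalization may move the witness `y`, so it is exchanged for a passive point of the same
      -- type, which stays fixed.
      obtain ⟨z, hxz, hz⟩ := hX.exists_passive (U := X.typeFiber v hfin y) hxy rfl
      have hz' := (ih hφ' z).1 (hx (X.toQuot hX.1 z) hxz)
      exact hy ((mem_interp_of_truthType_eq
        (truthType_normalize_of_mem_passive hz) hφ').1 hz')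
    · intro hx q hq
      obtain ⟨y, rfl⟩ := toQuot_surjective hX.1 q
      obtain ⟨hy, hy'⟩ := hX.1.filtrationRel_of_rel hq φ hφ hx
      refine (ih hφ' y).2 ?_
      -- Since `y` satisfies both `φ` and `□φ`, its normalization satisfies `φ`, either by equality
      -- of types or by the filtration relation.
      rcases normalize_equiv (v := v) (hfin := hfin) (hS := hS) y with h | ⟨_, h⟩
      · exact (mem_interp_of_truthType_eq h hφ').2 hy
      · exact (h φ hφ hy').1

/-! ### Pullback along the quotient map, and transfer of global truth. -/

/-- The pullback of a valuation along the quotient map. -/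
def pullback (X : ModalSpace.{u}) (h : X.IsK4)
    (w : ℕ → Clopens (sigma (rho X h)).carrier) (n : ℕ) : Clopens X.carrier :=
  ⟨X.toQuot h ⁻¹' (w n), (X.isClopen_quot_iff h _).1 (w n).isClopen⟩

theorem mem_interp_pullback (h : X.IsK4) (w : ℕ → Clopens (sigma (rho X h)).carrier)
    (φ : Formula) (x : X.carrier) :
    x ∈ X.interp (X.pullback h w) φ ↔ X.toQuot h x ∈ (sigma (rho X h)).interp w φ := by
  induction φ generalizing x with
  | var n => exact Iff.rfl
  | bot => exact Iff.rfl
  | top => exact Iff.rfl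
  | and φ ψ ih₁ ih₂ => exact and_congr (ih₁ x) (ih₂ x)
  | neg φ ih => exact not_congr (ih x)
  | box φ ih =>
    constructor
    · intro hx q hq
      obtain ⟨y, rfl⟩ := toQuot_surjective h q
      exact (ih y).1 (hx y hq)
    · exact fun hx y hxy => (ih y).2 (hx (X.toQuot h y) hxy)

theorem holds_pullback (h : X.IsK4) (w : ℕ → Clopens (sigma (rho X h)).carrier)
    (φ : Formula) : X.Holds (X.pullback h w) φ ↔ (sigma (rho X h)).Holds w φ := by
  simp only [Holds, (toQuot_surjective h).forall, mem_interp_pullback]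

/-- Normalization need not reach every point, but it fixes the passive points, and every type
realized in `X` has one; so a formula of `S` refuted somewhere in `X` remains refuted. -/
theorem IsK4Grz.holds_quotValuation (hX : X.IsK4Grz) (hfin : S.Finite)
    (hS : SubformulaClosed S) {φ : Formula} (hφ : φ ∈ S) :
    (sigma (rho X hX.1)).Holds (quotValuation hX.1 v hfin hS) φ ↔ X.Holds v φ := by
  simp only [Holds, (toQuot_surjective hX.1).forall]
  constructor
  · intro h x
    obtain ⟨z, hz⟩ := hX.exists_passive_of_mem (U := X.typeFiber v hfin x) (x := x) rfl
    exact (mem_interp_of_truthType_eq (truthType_normalize_of_mem_passive hz) hφ).1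
      ((hX.mem_interp_quotValuation hfin hS hφ z).1 (h z))
  · exact fun h x => (hX.mem_interp_quotValuation hfin hS hφ x).2 (h _)

end ModalSpace

end ModalDuality

theorem mainTheorem5 (X : ModalDuality.ModalSpace.{u}) (hX : X.IsK4Grz)
    (r : ModalDuality.Rule) :
    X.Refutes r ↔ (ModalDuality.sigma (ModalDuality.rho X hX.1)).Refutes r := by
  classical
  refine not_congr ⟨fun h w hw => ?_, fun h v hv => ?_⟩
  · obtain ⟨δ, hδ, hh⟩ := h (X.pullback hX.1 w)
      fun γ hγ => (ModalDuality.ModalSpace.holds_pullback hX.1 w γ).2 (hw γ hγ)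
    exact ⟨δ, hδ, (ModalDuality.ModalSpace.holds_pullback hX.1 w δ).1 hh⟩
  -- One set covers premises and conclusions, so a single valuation on `σρX` handles the whole rule.
  · obtain ⟨P, hPfin, hP, hPr⟩ :=
      ModalDuality.exists_finite_subformulaClosed (r.premises ∪ r.conclusions)
    obtain ⟨δ, hδ, hh⟩ := h (ModalDuality.ModalSpace.quotValuation hX.1 v hPfin hP)
      fun γ hγ => (hX.holds_quotValuation hPfin hP
        (hPr γ (Finset.mem_union_left _ hγ))).2 (hv γ hγ)
    exact ⟨δ, hδ, (hX.holds_quotValuation hPfin hP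
      (hPr δ (Finset.mem_union_right _ hδ))).1 hh⟩
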